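/- **Proposition 4.1.** Let $R$ be a regular semi-local integral domain of dimension $2$ in which $2$ is a unit. Suppose that $R$ has exactly three maximal ideals $m_1, m_2, m_3$ (pairwise distinct), and that there are elements $\pi_1,\pi_2,\pi_3\in R$ with $m_1=(\pi_2,\pi_3)$, $m_2=(\pi_1,\pi_3)$, $m_3=(\pi_1,\pi_2)$, each $(\pi_i)$ being a prime ideal. Let $K$ be the field of fractions of $R$, and put $a=\pi_2\pi_3$, $b=\pi_3\pi_1$, $c=\pi_1\pi_2\pi_3$. Then the affine $K$-variety with equation $$(X_1^2-aY_1^2)(X_2^2-bY_2^2)(X_3^2-abY_3^2)=c$$ in the six variables $X_1,Y_1,X_2,Y_2,X_3,Y_3$ has no $K$-rational point. -/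

import Mathlib

open AlgebraicGeometry CategoryTheory

noncomputable section

universe u

/-- The polynomial `(X₁² - aY₁²)(X₂² - bY₂²)(X₃² - abY₃²) - c` in six variables over `K`.
The variables `X₁, X₂, X₃` are indexed by `Sum.inl 0, Sum.inl 1, Sum.inl 2`, and
`Y₁, Y₂, Y₃` by `Sum.inr 0, Sum.inr 1, Sum.inr 2`. -/
def threeNormPolynomial {K : Type u} [Field K] (a b c : K) : MvPolynomial (Fin 3 ⊕ Fin 3) K :=
  (MvPolynomial.X (Sum.inl 0) ^ 2 - MvPolynomial.C a * MvPolynomial.X (Sum.inr 0) ^ 2) *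
  (MvPolynomial.X (Sum.inl 1) ^ 2 - MvPolynomial.C b * MvPolynomial.X (Sum.inr 1) ^ 2) *
  (MvPolynomial.X (Sum.inl 2) ^ 2 - MvPolynomial.C (a * b) * MvPolynomial.X (Sum.inr 2) ^ 2) -
  MvPolynomial.C c

/-- The coordinate ring of the affine hypersurface
`(X₁² - aY₁²)(X₂² - bY₂²)(X₃² - abY₃²) = c` over `K`. -/
abbrev ThreeNormRing {K : Type u} [Field K] (a b c : K) : Type u :=
  MvPolynomial (Fin 3 ⊕ Fin 3) K ⧸ Ideal.span {threeNormPolynomial a b c}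

/-- The affine `K`-scheme with equation `(X₁² - aY₁²)(X₂² - bY₂²)(X₃² - abY₃²) = c`. -/
def threeNormVariety {K : Type u} [Field K] (a b c : K) : Scheme.{u} :=
  Spec (CommRingCat.of (ThreeNormRing a b c))

/-- Its structure morphism to `Spec K`. -/
def threeNormVarietyStructure {K : Type u} [Field K] (a b c : K) :
    threeNormVariety a b c ⟶ Spec (CommRingCat.of K) :=
  Spec.map (CommRingCat.ofHom (algebraMap K (ThreeNormRing a b c)))

/-- The set `X(K)` of `K`-rational points of a `K`-scheme `p : X ⟶ Spec K`: the sections of `p`. -/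
def RationalPoints {K : Type u} [Field K] {X : Scheme.{u}} (p : X ⟶ Spec (CommRingCat.of K)) :
    Type u :=
  { s : Spec (CommRingCat.of K) ⟶ X // s ≫ p = 𝟙 (Spec (CommRingCat.of K)) }

/-- Rational points of the variety exist exactly when the equation has a solution in `K`. -/
theorem nonempty_rationalPoints_threeNormVariety {K : Type u} [Field K] (a b c : K) :
    Nonempty (RationalPoints (threeNormVarietyStructure a b c)) ↔
      ∃ x₁ y₁ x₂ y₂ x₃ y₃ : K,
        (x₁ ^ 2 - a * y₁ ^ 2) * (x₂ ^ 2 - b * y₂ ^ 2) * (x₃ ^ 2 - a * b * y₃ ^ 2) = c := by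
  constructor
  · rintro ⟨s, hs⟩
    obtain ⟨φ, rfl⟩ := Spec.map_surjective (R := CommRingCat.of (ThreeNormRing a b c)) s
    have h1 : CommRingCat.ofHom (algebraMap K (ThreeNormRing a b c)) ≫ φ = 𝟙 _ := by
      apply Spec.map_injective
      rw [Spec.map_comp, Spec.map_id]
      exact hs
    have h2 : ∀ k : K, φ.hom (algebraMap K (ThreeNormRing a b c) k) = k := fun k => by
      have := congrArg (fun f => f.hom k) h1
      simpa using this
    let ψ : MvPolynomial (Fin 3 ⊕ Fin 3) K →+* K :=
      φ.hom.comp (Ideal.Quotient.mk (Ideal.span {threeNormPolynomial a b c}))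
    have hC : ∀ k : K, ψ (MvPolynomial.C k) = k := h2
    have h0 : ψ (threeNormPolynomial a b c) = 0 := by
      have : Ideal.Quotient.mk (Ideal.span {threeNormPolynomial a b c})
          (threeNormPolynomial a b c) = 0 :=
        Ideal.Quotient.eq_zero_iff_mem.2 (Ideal.mem_span_singleton_self _)
      simp only [ψ, RingHom.comp_apply, this, map_zero]
    refine ⟨ψ (.X (.inl 0)), ψ (.X (.inr 0)), ψ (.X (.inl 1)), ψ (.X (.inr 1)),
      ψ (.X (.inl 2)), ψ (.X (.inr 2)), ?_⟩
    simp only [threeNormPolynomial, map_sub, map_mul, map_pow, hC] at h0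
    exact sub_eq_zero.1 h0
  · rintro ⟨x₁, y₁, x₂, y₂, x₃, y₃, h⟩
    let v : Fin 3 ⊕ Fin 3 → K := Sum.elim ![x₁, x₂, x₃] ![y₁, y₂, y₃]
    let φ : ThreeNormRing a b c →+* K :=
      Ideal.Quotient.lift _ (MvPolynomial.eval v) (by
        intro p hp
        obtain ⟨q, rfl⟩ := Ideal.mem_span_singleton.1 hp
        rw [map_mul]
        have : MvPolynomial.eval v (threeNormPolynomial a b c) = 0 := by
          simp [threeNormPolynomial, v, h]
        rw [this, zero_mul])
    refine ⟨⟨Spec.map (CommRingCat.ofHom φ), ?_⟩⟩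
    unfold threeNormVarietyStructure
    rw [← Spec.map_id]
    refine (Spec.map_comp _ _).symm.trans (congrArg Spec.map ?_)
    ext k
    exact MvPolynomial.eval_C k

end

/-! ### Intersection numbers of curves on a surface, and their parity. -/

section IntersectionMultiplicity

variable {S : Type*} [CommRing S]

/-! Clearing denominators gives F₁F₂F₃ = π₁π₂π₃w² in R, where Fᵢ = xᵢ² - πⱼπₖyᵢ² with {i, j, k} =
{1, 2, 3}. The contradiction comes from the parity of the sum of the nine orders of the Fᵢ at the
πⱼ: the right-hand side makes it odd, as it has odd order at each of the three primes. On the other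
side, each Fᵢ contributes an even amount.

The order of Fᵢ at πᵢ is even (`even_multiplicity_of_norm`): otherwise πⱼπₖ would be a square modulo
πᵢ, but at a vertex of the triangle it meets πᵢ with multiplicity one.

The orders of Fᵢ at πⱼ and πₖ have even sum (`even_multiplicity_add_of_norm_equation`). In the
factorial local ring at (πⱼ, πₖ), a residue computation along one of these two curves reduces this
to evenness of its intersection with the rest of the divisor of Fᵢ. A component of odd order there
also has odd order in another factor, which forces it to meet the curve evenly. -/

/-- The intersection multiplicity of `f` and `g`: the length of `S ⧸ (f, g)`. -/
noncomputable def intersectionMultiplicity (f g : S) : ℕ :=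
  (Module.length S (S ⧸ Ideal.span {f, g})).toNat

theorem Ring.ord_quotient_span_singleton_mk (f g : S) :
    Ring.ord (S ⧸ Ideal.span {f}) (Ideal.Quotient.mk _ g) =
      Module.length S (S ⧸ Ideal.span {f, g}) := by
  rw [Ring.ord, ← Module.length_eq_of_surjective (R := S ⧸ Ideal.span {f}) (S := S)
    (M := (S ⧸ Ideal.span {f}) ⧸ Ideal.span {Ideal.Quotient.mk (Ideal.span {f}) g})
    Ideal.Quotient.mk_surjective]
  have h1 : Ideal.span {Ideal.Quotient.mk (Ideal.span {f}) g} =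
      (Ideal.span {g}).map (Ideal.Quotient.mkₐ S (Ideal.span {f})) := by
    rw [Ideal.map_span, Set.image_singleton]; rfl
  have h2 : Ideal.span {f, g} = Ideal.span {f} ⊔ Ideal.span {g} := by
    rw [← Ideal.span_union]; rfl
  rw [h1, h2]
  exact (DoubleQuot.quotQuotEquivQuotSupₐ S (Ideal.span {f}) (Ideal.span {g})).toLinearEquiv.length_eq

theorem intersectionMultiplicity_eq_ord (f g : S) : intersectionMultiplicity f g =
    (Ring.ord (S ⧸ Ideal.span {f}) (Ideal.Quotient.mk _ g)).toNat := by
  rw [intersectionMultiplicity, Ring.ord_quotient_span_singleton_mk]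

theorem intersectionMultiplicity_comm (f g : S) :
    intersectionMultiplicity f g = intersectionMultiplicity g f := by
  rw [intersectionMultiplicity, intersectionMultiplicity, Set.pair_comm]

theorem intersectionMultiplicity_of_isUnit (f : S) {g : S} (hg : IsUnit g) :
    intersectionMultiplicity f g = 0 := by
  rw [intersectionMultiplicity_eq_ord, Ring.ord_of_isUnit (hg.map _)]; rfl

theorem intersectionMultiplicity_congr {f g h : S} (hgh : f ∣ g - h) :
    intersectionMultiplicity f g = intersectionMultiplicity f h := by
  rw [intersectionMultiplicity_eq_ord, intersectionMultiplicity_eq_ord,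
    (Ideal.Quotient.eq (I := Ideal.span {f})).2 (Ideal.mem_span_singleton.2 hgh)]

theorem intersectionMultiplicity_eq_one {f g : S} (h : (Ideal.span {f, g}).IsMaximal) :
    intersectionMultiplicity f g = 1 := by
  have : IsSimpleModule S (S ⧸ Ideal.span {f, g}) :=
    isSimpleModule_iff_isCoatom.2 h.out
  rw [intersectionMultiplicity, Module.length_eq_one]; rfl

variable [IsDomain S] [IsNoetherianRing S]

/-- Additivity of `Ring.ord` on the domain S/(f), of dimension at most one. Non-divisibility by f
keeps the lengths finite; `toNat` would send an infinite length to 0. -/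
theorem intersectionMultiplicity_mul (hdim : ringKrullDim S ≤ 2) {f g h : S} (hf : Prime f)
    (hg : ¬ f ∣ g) (hh : ¬ f ∣ h) : intersectionMultiplicity f (g * h) =
      intersectionMultiplicity f g + intersectionMultiplicity f h := by
  have : (Ideal.span {f}).IsPrime := (Ideal.span_singleton_prime hf.ne_zero).2 hf
  have hk : Ring.KrullDimLE 1 (S ⧸ Ideal.span {f}) := by
    rw [Ring.krullDimLE_iff]
    have := (ringKrullDim_quotient_succ_le_of_nonZeroDivisor
      (mem_nonZeroDivisors_of_ne_zero hf.ne_zero)).trans hdim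
    rw [← ENat.WithBot.add_le_add_one_right_iff]
    simpa [one_add_one_eq_two] using this
  have aux {x : S} (hx : ¬ f ∣ x) :
      Ideal.Quotient.mk (Ideal.span {f}) x ∈ nonZeroDivisors (S ⧸ Ideal.span {f}) := by
    apply mem_nonZeroDivisors_of_ne_zero
    rwa [Ne, Ideal.Quotient.eq_zero_iff_mem, Ideal.mem_span_singleton]
  simp only [intersectionMultiplicity_eq_ord]
  rw [map_mul, Ring.ord_mul _ (aux hh), ENat.toNat_add (Ring.ord_ne_top (aux hg))
    (Ring.ord_ne_top (aux hh))]

theorem intersectionMultiplicity_pow (hdim : ringKrullDim S ≤ 2) {f g : S} (hf : Prime f)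
    (hg : ¬ f ∣ g) (n : ℕ) :
    intersectionMultiplicity f (g ^ n) = n * intersectionMultiplicity f g := by
  induction n with
  | zero => simp [intersectionMultiplicity_of_isUnit]
  | succ n ih =>
    rw [pow_succ, intersectionMultiplicity_mul hdim hf (fun h ↦ hg (hf.dvd_of_dvd_pow h)) hg, ih]
    ring

/-- If every prime occurring in `g` with odd exponent meets `f` evenly, so does `g`. -/
theorem even_intersectionMultiplicity_of_forall_prime [UniqueFactorizationMonoid S]
    (hdim : ringKrullDim S ≤ 2) {f : S} (hf : Prime f) (g : S) (hg : ¬ f ∣ g)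
    (H : ∀ p, Prime p → p ∣ g → Odd (multiplicity p g) → Even (intersectionMultiplicity f p)) :
    Even (intersectionMultiplicity f g) := by
  induction g using UniqueFactorizationMonoid.induction_on_coprime with
  | h0 => simp at hg
  | h1 hx => simp [intersectionMultiplicity_of_isUnit f hx]
  | @hpr p i hp =>
    rcases Nat.eq_zero_or_pos i with rfl | hi
    · simp [intersectionMultiplicity_of_isUnit]
    have hfp : ¬ f ∣ p := fun h ↦ hg (h.trans (dvd_pow_self p hi.ne'))
    rw [intersectionMultiplicity_pow hdim hf hfp, Nat.even_mul, or_iff_not_imp_left,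
      Nat.not_even_iff_odd]
    intro hodd
    exact H p hp (dvd_pow_self p hi.ne') (by rwa [multiplicity_pow_self_of_prime hp])
  | @hcp x y hxy ihx ihy =>
    have hx : ¬ f ∣ x := fun h ↦ hg (h.mul_right y)
    have hy : ¬ f ∣ y := fun h ↦ hg (h.mul_left x)
    have h0 : x * y ≠ 0 := by rintro h; simp [h] at hg
    rw [intersectionMultiplicity_mul hdim hf hx hy]
    refine (ihx hx fun p hp hpx hodd ↦ H p hp (hpx.mul_right y) ?_).add
      (ihy hy fun p hp hpy hodd ↦ H p hp (hpy.mul_left x) ?_)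
    · rwa [multiplicity_mul hp (.of_prime_left hp h0),
        multiplicity_eq_zero.2 (fun hpy ↦ hp.not_isUnit (hxy hpx hpy)), add_zero]
    · rwa [multiplicity_mul hp (.of_prime_left hp h0),
        multiplicity_eq_zero.2 (fun hpx ↦ hp.not_isUnit (hxy hpx hpy)), zero_add]

/-- If `x² - d y²` has odd order at a prime `p`, then `d` is a square modulo `p`. -/
theorem exists_dvd_sq_sub_of_odd_multiplicity {p d x y : S} (hp : Prime p)
    (h0 : x ^ 2 - d * y ^ 2 ≠ 0) (hodd : Odd (multiplicity p (x ^ 2 - d * y ^ 2))) :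
    ∃ s t, ¬ p ∣ s ∧ p ∣ t ^ 2 - d * s ^ 2 := by
  generalize hn : multiplicity p (x ^ 2 - d * y ^ 2) = n at hodd
  induction n using Nat.strong_induction_on generalizing x y with
  | _ n ih =>
    have hdvd : p ∣ x ^ 2 - d * y ^ 2 := by
      by_contra h
      rw [multiplicity_eq_zero.2 h] at hn
      simp [← hn] at hodd
    by_cases hy : p ∣ y
    -- Descent: p then divides both coordinates, and cancelling p² keeps the parity of the order.
    · have hx : p ∣ x := by
        refine hp.dvd_of_dvd_pow (n := 2) ?_
        have := dvd_add hdvd ((hy.mul_left (d * y)))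
        convert this using 1
        ring
      obtain ⟨x, rfl⟩ := hx
      obtain ⟨y, rfl⟩ := hy
      have e : (p * x) ^ 2 - d * (p * y) ^ 2 = p ^ 2 * (x ^ 2 - d * y ^ 2) := by ring
      rw [e] at h0 hn
      rw [multiplicity_mul hp (.of_prime_left hp h0), multiplicity_pow_self_of_prime hp] at hn
      refine ih _ (by omega) (right_ne_zero_of_mul h0) rfl ?_
      rw [Nat.odd_iff] at hodd ⊢
      omega
    · exact ⟨y, x, hy, hdvd⟩

/-- Along a prime `v ∥ d`, the order at `v` of a value of `x² - d y²` and the order of its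
leading coefficient modulo `v` have the same parity. -/
theorem even_intersectionMultiplicity_add_of_norm (hdim : ringKrullDim S ≤ 2) {u v : S}
    (hv : Prime v) (huv : ¬ v ∣ u) (hone : Odd (intersectionMultiplicity v u)) {x y g : S} {j : ℕ}
    (h : x ^ 2 - u * v * y ^ 2 = v ^ j * g) (hg : ¬ v ∣ g) :
    Even (intersectionMultiplicity v g + j) := by
  induction j using Nat.strong_induction_on generalizing x y with
  | _ j ih =>
    by_cases hx : v ∣ x
    swap
    · have hj : j = 0 := by
        by_contra hj
        refine hx (hv.dvd_of_dvd_pow (n := 2) ?_)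
        rw [sub_eq_iff_eq_add.1 h]
        exact dvd_add ((dvd_pow_self v hj).mul_right g) (Dvd.intro _ (by ring : v * (u * y ^ 2) = _))
      subst hj
      -- Here g ≡ x² modulo v.
      rw [intersectionMultiplicity_congr (h := x ^ 2) ⟨-(u * y ^ 2), by linear_combination -h⟩,
        intersectionMultiplicity_pow hdim hv hx]
      simp
    obtain ⟨x, rfl⟩ := hx
    by_cases hy : v ∣ y
    · obtain ⟨y, rfl⟩ := hy
      have e : v ^ 2 * (x ^ 2 - u * v * y ^ 2) = v ^ j * g := by rw [← h]; ring
      have hj : 2 ≤ j := by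
        by_contra hj
        obtain ⟨i, hi⟩ : ∃ i, j + (i + 1) = 2 := ⟨1 - j, by omega⟩
        have e' : v ^ j * (v * (v ^ i * (x ^ 2 - u * v * y ^ 2))) = v ^ j * g := by
          rw [← e, ← hi]; ring
        exact hg ⟨_, (mul_left_cancel₀ (pow_ne_zero j hv.ne_zero) e').symm⟩
      obtain ⟨i, rfl⟩ := Nat.exists_eq_add_of_le hj
      rw [pow_add, mul_assoc (v ^ 2)] at e
      have := ih i (by omega) (mul_left_cancel₀ (pow_ne_zero 2 hv.ne_zero) e)
      simpa [parity_simps] using this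
    · have e : v * (v * x ^ 2 - u * y ^ 2) = v ^ j * g := by rw [← h]; ring
      have huy : ¬ v ∣ u * y ^ 2 := fun h ↦ (hv.dvd_or_dvd h).elim huv
        fun h ↦ hy (hv.dvd_of_dvd_pow h)
      have hj : j = 1 := by
        rcases j with _ | _ | j
        · exact absurd ⟨_, by simpa using e.symm⟩ hg
        · rfl
        · have e' : v * x ^ 2 - u * y ^ 2 = v ^ (j + 1) * g :=
            mul_left_cancel₀ hv.ne_zero (by rw [e]; ring)
          refine absurd ?_ huy
          rw [← sub_sub_self (v * x ^ 2) (u * y ^ 2), e']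
          exact dvd_sub (Dvd.intro _ rfl) (Dvd.intro _ (by ring : v * (v ^ j * g) = _))
      subst hj
      have e' : v * x ^ 2 - u * y ^ 2 = g := mul_left_cancel₀ hv.ne_zero (by rw [e]; ring)
      -- Here g ≡ -u y² modulo v: the odd intersection of v with u compensates j = 1.
      rw [intersectionMultiplicity_congr (h := -1 * (u * y ^ 2)) ⟨x ^ 2, by linear_combination -e'⟩,
        intersectionMultiplicity_mul hdim hv (by simpa [← isUnit_iff_dvd_one] using hv.not_isUnit) huy,
        intersectionMultiplicity_mul hdim hv huv (fun h ↦ hy (hv.dvd_of_dvd_pow h)),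
        intersectionMultiplicity_pow hdim hv hy, intersectionMultiplicity_of_isUnit v (by simp)]
      obtain ⟨n, hn⟩ := hone
      exact ⟨n + 1 + intersectionMultiplicity v y, by omega⟩

/-- If `e v` is a nonzero square modulo the prime `p` and `p` meets `e` evenly, then `p` meets `v`
evenly. -/
theorem even_intersectionMultiplicity_of_dvd_sq_sub (hdim : ringKrullDim S ≤ 2) {p v e s t : S}
    (hp : Prime p) (hpv : ¬ p ∣ v) (hpe : ¬ p ∣ e) (he : Even (intersectionMultiplicity p e))
    (hs : ¬ p ∣ s) (h : p ∣ t ^ 2 - e * v * s ^ 2) : Even (intersectionMultiplicity p v) := by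
  have hs2 : ¬ p ∣ s ^ 2 := fun h ↦ hs (hp.dvd_of_dvd_pow h)
  have hev : ¬ p ∣ e * v := fun h ↦ (hp.dvd_or_dvd h).elim hpe hpv
  have ht : ¬ p ∣ t := fun ht ↦ by
    have : p ∣ e * v * s ^ 2 := by
      rw [← sub_sub_self (t ^ 2) (e * v * s ^ 2)]
      exact dvd_sub (dvd_pow ht two_ne_zero) h
    exact (hp.dvd_or_dvd this).elim hev hs2
  -- Intersecting p with t² ≡ e v s² gives 2(p·t) = (p·e) + (p·v) + 2(p·s).
  have := intersectionMultiplicity_congr h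
  rw [intersectionMultiplicity_mul hdim hp hev hs2, intersectionMultiplicity_mul hdim hp hpe hpv,
    intersectionMultiplicity_pow hdim hp hs, intersectionMultiplicity_pow hdim hp ht] at this
  obtain ⟨n, hn⟩ := he
  rw [Nat.even_iff]
  omega

end IntersectionMultiplicity

/-! ### The parity argument at one vertex. -/

section LocalRing

variable {S : Type*} [CommRing S] [IsDomain S] [IsNoetherianRing S] [IsLocalRing S]

open IsLocalRing

/-- A Noetherian local domain with maximal ideal generated by `u` and a prime `v` is factorial. -/
theorem uniqueFactorizationMonoid_of_maximalIdeal_eq_span_pair {u v : S} (hv : Prime v)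
    (hm : maximalIdeal S = Ideal.span {u, v}) : UniqueFactorizationMonoid S := by
  refine UniqueFactorizationMonoid.iff_exists_prime_mem_of_isPrime.2 fun P hP0 hP ↦ ?_
  by_cases hvP : v ∈ P
  · exact ⟨v, hvP, hv⟩
  have : (Ideal.span {v}).IsPrime := (Ideal.span_singleton_prime hv.ne_zero).2 hv
  have : IsLocalRing (S ⧸ Ideal.span {v}) :=
    .of_surjective' (Ideal.Quotient.mk _) Ideal.Quotient.mk_surjective
  have hmap : maximalIdeal (S ⧸ Ideal.span {v}) = Ideal.span {Ideal.Quotient.mk _ u} := by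
    have hcomap := eq_maximalIdeal (Ideal.comap_isMaximal_of_surjective
      (Ideal.Quotient.mk (Ideal.span {v})) Ideal.Quotient.mk_surjective
      (K := maximalIdeal (S ⧸ Ideal.span {v})))
    rw [← Ideal.map_comap_of_surjective _ (Ideal.Quotient.mk_surjective (I := Ideal.span {v}))
      (maximalIdeal (S ⧸ Ideal.span {v})), hcomap, hm, Ideal.map_span, Set.image_pair,
      Ideal.Quotient.eq_zero_iff_mem.2 (Ideal.mem_span_singleton_self v), Ideal.span_pair_zero]
  have hpir : IsPrincipalIdealRing (S ⧸ Ideal.span {v}) :=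
    ((tfae_of_isNoetherianRing_of_isLocalRing_of_isDomain (S ⧸ Ideal.span {v})).out 0 4
      :).2 ⟨⟨_, hmap⟩⟩
  obtain ⟨f', hf'⟩ := (hpir.principal (P.map (Ideal.Quotient.mk (Ideal.span {v})))).principal
  have hmem : f' ∈ P.map (Ideal.Quotient.mk (Ideal.span {v})) := by
    rw [hf']; exact Submodule.mem_span_singleton_self _
  obtain ⟨f, hf, rfl⟩ :=
    (Ideal.mem_map_iff_of_surjective _ Ideal.Quotient.mk_surjective).1 hmem
  -- S/(v) is a principal ideal ring and v ∉ P, so P ⊆ (f) + vP; Nakayama removes vP.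
  have hle : P ≤ Ideal.span {f} := by
    refine Submodule.le_of_le_smul_of_le_jacobson_bot (I := Ideal.span {v})
      (IsNoetherian.noetherian P) ?_ ?_
    · rw [jacobson_eq_maximalIdeal _ bot_ne_top, hm]
      exact Ideal.span_mono (by simp)
    · intro a ha
      have := Ideal.mem_map_of_mem (Ideal.Quotient.mk (Ideal.span {v})) ha
      rw [hf'] at this
      obtain ⟨b', hb'⟩ := Submodule.mem_span_singleton.1 this
      obtain ⟨b, rfl⟩ := Ideal.Quotient.mk_surjective b'
      rw [smul_eq_mul, ← map_mul, eq_comm, Ideal.Quotient.eq, Ideal.mem_span_singleton] at hb'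
      obtain ⟨c, hc⟩ := hb'
      have hcP : c ∈ P := by
        refine (hP.mem_or_mem ?_).resolve_left hvP
        rw [← hc]
        exact P.sub_mem ha (P.mul_mem_left b hf)
      rw [sub_eq_iff_eq_add'] at hc
      rw [hc]
      exact Submodule.add_mem_sup (Ideal.mul_mem_left _ _ (Ideal.mem_span_singleton_self f))
        (Submodule.smul_mem_smul (Ideal.mem_span_singleton_self v) hcP)
  have hPf : P = Ideal.span {f} :=
    le_antisymm hle ((Ideal.span_singleton_le_iff_mem _).2 hf)
  refine ⟨f, hf, (Ideal.span_singleton_prime ?_).1 (hPf ▸ hP)⟩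
  rintro rfl
  exact hP0 (by simpa using hPf)

/-- Along v the first factor has leading coefficient u^k H, so k + (v·H) + j is even. It remains
that v meets H evenly, which is checked on the primes of odd order in H. -/
theorem even_add_of_norm_equation_of_isLocalRing (hdim : ringKrullDim S ≤ 2) {u v e : S}
    (hu : Prime u) (hv : Prime v) (hvu : ¬ v ∣ u) (he : IsUnit e)
    (hm : maximalIdeal S = Ideal.span {u, v}) {x₁ y₁ x₂ y₂ x₃ y₃ w H : S} {k j : ℕ} (hw : w ≠ 0)
    (h : (x₁ ^ 2 - u * v * y₁ ^ 2) * (x₂ ^ 2 - e * v * y₂ ^ 2) * (x₃ ^ 2 - e * u * y₃ ^ 2) =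
      e * u * v * w ^ 2)
    (hH : x₁ ^ 2 - u * v * y₁ ^ 2 = u ^ k * v ^ j * H) (huH : ¬ u ∣ H) (hvH : ¬ v ∣ H) :
    Even (k + j) := by
  have := uniqueFactorizationMonoid_of_maximalIdeal_eq_span_pair hv hm
  have hone : intersectionMultiplicity v u = 1 := by
    rw [intersectionMultiplicity_comm]
    exact intersectionMultiplicity_eq_one (hm ▸ maximalIdeal.isMaximal S)
  have hvuk : ¬ v ∣ u ^ k := fun h ↦ hvu (hv.dvd_of_dvd_pow h)
  have h1 : Even (intersectionMultiplicity v (u ^ k * H) + j) :=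
    even_intersectionMultiplicity_add_of_norm hdim hv hvu (by simp [hone])
      (by rw [hH]; ring) (fun h ↦ (hv.dvd_or_dvd h).elim hvuk hvH)
  rw [intersectionMultiplicity_mul hdim hv hvuk hvH, intersectionMultiplicity_pow hdim hv hvu,
    hone] at h1
  suffices Even (intersectionMultiplicity v H) by
    rw [Nat.even_iff] at *
    omega
  have h0 : e * u * v * w ^ 2 ≠ 0 := mul_ne_zero
    (mul_ne_zero (mul_ne_zero he.ne_zero hu.ne_zero) hv.ne_zero) (pow_ne_zero 2 hw)
  have h00 := h0
  rw [← h] at h00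
  have hF1 := left_ne_zero_of_mul (left_ne_zero_of_mul h00)
  have hF2 := right_ne_zero_of_mul (left_ne_zero_of_mul h00)
  have hF3 := right_ne_zero_of_mul h00
  refine even_intersectionMultiplicity_of_forall_prime hdim hv H hvH fun p hp hpH hodd ↦ ?_
  have hpu : ¬ p ∣ u := fun hpu ↦ huH
    ((hp.associated_of_dvd hu hpu).symm.dvd.trans hpH)
  have hpv : ¬ p ∣ v := fun hpv ↦ hvH
    ((hp.associated_of_dvd hv hpv).symm.dvd.trans hpH)
  have hpe : ¬ p ∣ e := fun h ↦ hp.not_isUnit (isUnit_of_dvd_unit h he)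
  have he0 : Even (intersectionMultiplicity p e) := by
    simp [intersectionMultiplicity_of_isUnit p he]
  have hodd1 : Odd (multiplicity p (x₁ ^ 2 - u * v * y₁ ^ 2)) := by
    rw [hH] at hF1 ⊢
    rwa [multiplicity_mul hp (.of_prime_left hp hF1), multiplicity_eq_zero.2, zero_add]
    exact fun h ↦ (hp.dvd_or_dvd h).elim (fun h ↦ hpu (hp.dvd_of_dvd_pow h))
      (fun h ↦ hpv (hp.dvd_of_dvd_pow h))
  have hsum : Odd (multiplicity p (x₂ ^ 2 - e * v * y₂ ^ 2) +
      multiplicity p (x₃ ^ 2 - e * u * y₃ ^ 2)) := by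
    have h2 := congrArg (multiplicity p) h
    rw [multiplicity_mul hp (.of_prime_left hp h00),
      multiplicity_mul hp (.of_prime_left hp (left_ne_zero_of_mul h00)),
      multiplicity_mul hp (.of_prime_left hp h0),
      FiniteMultiplicity.multiplicity_pow hp (.of_prime_left hp hw),
      multiplicity_eq_zero.2 (fun h ↦ (hp.dvd_or_dvd h).elim
        (fun h ↦ (hp.dvd_or_dvd h).elim hpe hpu) hpv)] at h2
    rw [Nat.odd_iff] at *
    omega
  rw [intersectionMultiplicity_comm]
  -- Exactly one of the other two factors has odd order at p; either way e v becomes a square modulo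
  -- p.
  rcases Nat.even_or_odd (multiplicity p (x₂ ^ 2 - e * v * y₂ ^ 2)) with h2 | h2
  · have h3 := (Nat.odd_add'.1 hsum).2 h2
    obtain ⟨s, t, hs, hst⟩ := exists_dvd_sq_sub_of_odd_multiplicity hp hF1 hodd1
    obtain ⟨s', t', hs', hst'⟩ := exists_dvd_sq_sub_of_odd_multiplicity hp hF3 h3
    -- Multiply t² ≡ uv s² by t'² ≡ eu s'²: (tt')² ≡ ev (uss')² modulo p.
    refine even_intersectionMultiplicity_of_dvd_sq_sub (s := u * s * s') (t := t * t') hdim hp hpv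
      hpe he0 (fun h ↦ (hp.dvd_or_dvd h).elim
        (fun h ↦ (hp.dvd_or_dvd h).elim hpu hs) hs') ?_
    obtain ⟨α, hα⟩ := hst
    obtain ⟨β, hβ⟩ := hst'
    exact ⟨α * t' ^ 2 + u * v * s ^ 2 * β, by
      linear_combination t' ^ 2 * hα + u * v * s ^ 2 * hβ⟩
  · obtain ⟨s, t, hs, hst⟩ := exists_dvd_sq_sub_of_odd_multiplicity hp hF2 h2
    exact even_intersectionMultiplicity_of_dvd_sq_sub hdim hp hpv hpe he0 hs hst

end LocalRing

/-! ### Passage to the localizations and the global count. -/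

section Semilocal

variable {R : Type*} [CommRing R]

theorem ringKrullDim_localization_atPrime_le (m : Ideal R) [m.IsPrime] :
    ringKrullDim (Localization.AtPrime m) ≤ ringKrullDim R := by
  rw [IsLocalization.AtPrime.ringKrullDim_eq_height m]
  exact Ideal.height_le_ringKrullDim_of_ne_top Ideal.IsPrime.ne_top'

theorem Localization.AtPrime.maximalIdeal_eq_span_pair {m : Ideal R} [m.IsPrime] {u v : R}
    (hm : m = Ideal.span {u, v}) : IsLocalRing.maximalIdeal (Localization.AtPrime m) =
      Ideal.span {algebraMap R _ u, algebraMap R _ v} := by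
  rw [← Localization.AtPrime.map_eq_maximalIdeal, ← Set.image_pair, ← Ideal.map_span]
  exact congrArg (Ideal.map _) hm

variable [IsDomain R]

/-- Divisibility by a prime of `R` lying in `m` can be tested in the localization at `m`. -/
theorem Prime.algebraMap_dvd_algebraMap_iff {m : Ideal R} [m.IsPrime] {p : R} (hp : Prime p)
    (hpm : p ∈ m) (x : R) :
    algebraMap R (Localization.AtPrime m) p ∣ algebraMap R (Localization.AtPrime m) x ↔ p ∣ x := by
  refine ⟨?_, fun h ↦ map_dvd _ h⟩
  rintro ⟨y, hy⟩
  obtain ⟨⟨r, s⟩, hrs⟩ := IsLocalization.surj m.primeCompl y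
  have : algebraMap R (Localization.AtPrime m) (x * s) =
      algebraMap R (Localization.AtPrime m) (p * r) := by
    rw [map_mul, map_mul, ← hrs, hy, mul_assoc]
  have := IsLocalization.injective (Localization.AtPrime m) m.primeCompl_le_nonZeroDivisors this
  refine (hp.dvd_or_dvd (Dvd.intro r this.symm)).resolve_right fun h ↦ s.2 ?_
  exact Ideal.mem_of_dvd _ h hpm

theorem Prime.algebraMap_localization {m : Ideal R} [m.IsPrime] {p : R} (hp : Prime p)
    (hpm : p ∈ m) : Prime (algebraMap R (Localization.AtPrime m) p) := by
  have hinj := IsLocalization.injective (Localization.AtPrime m) m.primeCompl_le_nonZeroDivisors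
  have : (Ideal.span {p}).IsPrime := (Ideal.span_singleton_prime hp.ne_zero).2 hp
  have h1 := IsLocalization.isPrime_of_isPrime_disjoint m.primeCompl (Localization.AtPrime m)
    (Ideal.span {p}) this (by
      rw [Set.disjoint_left]
      intro x hx hxp
      exact hx (Ideal.mem_of_dvd _ (Ideal.mem_span_singleton.1 hxp) hpm))
  rw [Ideal.map_span, Set.image_singleton] at h1
  exact (Ideal.span_singleton_prime ((map_ne_zero_iff _ hinj).2 hp.ne_zero)).1 h1

variable [IsNoetherianRing R]

/-- Localize at m: since u and v lie in m, the cofactor left after extracting their powers stays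
prime to both. -/
theorem even_multiplicity_add_of_norm_equation (hdim : ringKrullDim R ≤ 2) {u v e : R}
    {m : Ideal R} (hmax : m.IsMaximal) (hm : m = Ideal.span {u, v})
    (hu : Prime u) (hv : Prime v) (hvu : ¬ v ∣ u) (he : e ∉ m)
    {x₁ y₁ x₂ y₂ x₃ y₃ w : R} (hw : w ≠ 0)
    (h : (x₁ ^ 2 - u * v * y₁ ^ 2) * (x₂ ^ 2 - e * v * y₂ ^ 2) * (x₃ ^ 2 - e * u * y₃ ^ 2) =
      e * u * v * w ^ 2) :
    Even (multiplicity u (x₁ ^ 2 - u * v * y₁ ^ 2) + multiplicity v (x₁ ^ 2 - u * v * y₁ ^ 2)) := by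
  have := hmax.isPrime
  have hinj := IsLocalization.injective (Localization.AtPrime m) m.primeCompl_le_nonZeroDivisors
  have hum : u ∈ m := hm ▸ Ideal.subset_span (by simp)
  have hvm : v ∈ m := hm ▸ Ideal.subset_span (by simp)
  have he0 : e ≠ 0 := by rintro rfl; exact he m.zero_mem
  have hF : x₁ ^ 2 - u * v * y₁ ^ 2 ≠ 0 := by
    refine left_ne_zero_of_mul (left_ne_zero_of_mul (ne_of_eq_of_ne h ?_))
    exact mul_ne_zero (mul_ne_zero (mul_ne_zero he0 hu.ne_zero) hv.ne_zero) (pow_ne_zero 2 hw)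
  obtain ⟨G, hG, huG⟩ :=
    (FiniteMultiplicity.of_prime_left hu hF).exists_eq_pow_mul_and_not_dvd
  have hG0 : G ≠ 0 := by rintro rfl; simp at huG
  obtain ⟨H, hH, hvH⟩ :=
    (FiniteMultiplicity.of_prime_left hv hG0).exists_eq_pow_mul_and_not_dvd
  have huH : ¬ u ∣ H := fun h ↦ huG (hH ▸ h.mul_left _)
  have hvF : multiplicity v (x₁ ^ 2 - u * v * y₁ ^ 2) = multiplicity v G := by
    have hne := hF
    rw [hG] at hne
    rw [hG, multiplicity_mul hv (.of_prime_left hv hne),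
      multiplicity_eq_zero.2 (fun h ↦ hvu (hv.dvd_of_dvd_pow h)), zero_add]
  rw [hvF]
  generalize multiplicity u (x₁ ^ 2 - u * v * y₁ ^ 2) = k at *
  generalize multiplicity v G = j at *
  rw [hH, ← mul_assoc] at hG
  let φ := algebraMap R (Localization.AtPrime m)
  refine even_add_of_norm_equation_of_isLocalRing (S := Localization.AtPrime m)
    (u := φ u) (v := φ v) (e := φ e) (w := φ w) (H := φ H) (x₁ := φ x₁) (y₁ := φ y₁)
    (x₂ := φ x₂) (y₂ := φ y₂) (x₃ := φ x₃) (y₃ := φ y₃)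
    ((ringKrullDim_localization_atPrime_le m).trans hdim)
    (hu.algebraMap_localization hum) (hv.algebraMap_localization hvm)
    (by rwa [hv.algebraMap_dvd_algebraMap_iff hvm])
    (IsLocalization.map_units _ (⟨e, he⟩ : m.primeCompl))
    (Localization.AtPrime.maximalIdeal_eq_span_pair hm) ((map_ne_zero_iff _ hinj).2 hw)
    (by simpa only [map_mul, map_sub, map_pow] using congrArg φ h)
    (by simpa only [map_mul, map_sub, map_pow] using congrArg φ hG)
    (by rwa [hu.algebraMap_dvd_algebraMap_iff hum])
    (by rwa [hv.algebraMap_dvd_algebraMap_iff hvm])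

/-- An odd order would make q r a square modulo p, so p would meet q evenly at m, where r is a unit;
but p and q generate m, so they meet once. -/
theorem even_multiplicity_of_norm (hdim : ringKrullDim R ≤ 2) {p q r x y : R}
    {m : Ideal R} (hmax : m.IsMaximal) (hm : m = Ideal.span {p, q})
    (hp : Prime p) (hpq : ¬ p ∣ q) (hr : r ∉ m) (h0 : x ^ 2 - q * r * y ^ 2 ≠ 0) :
    Even (multiplicity p (x ^ 2 - q * r * y ^ 2)) := by
  by_contra hodd
  rw [Nat.not_even_iff_odd] at hodd
  have := hmax.isPrime
  have hpm : p ∈ m := hm ▸ Ideal.subset_span (by simp)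
  obtain ⟨s, t, hs, hst⟩ := exists_dvd_sq_sub_of_odd_multiplicity hp h0 hodd
  let φ := algebraMap R (Localization.AtPrime m)
  have hru : IsUnit (φ r) := IsLocalization.map_units _ (⟨r, hr⟩ : m.primeCompl)
  have hp' := hp.algebraMap_localization hpm
  have h1 : Even (intersectionMultiplicity (φ p) (φ q)) := by
    refine even_intersectionMultiplicity_of_dvd_sq_sub (e := φ r) (s := φ s) (t := φ t)
      ((ringKrullDim_localization_atPrime_le m).trans hdim) hp'
      (by rwa [hp.algebraMap_dvd_algebraMap_iff hpm])
      (fun h ↦ hp'.not_isUnit (isUnit_of_dvd_unit h hru))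
      (by simp [intersectionMultiplicity_of_isUnit _ hru])
      (by rwa [hp.algebraMap_dvd_algebraMap_iff hpm]) ?_
    rw [mul_comm (φ r)]
    simpa only [map_mul, map_sub, map_pow] using map_dvd φ hst
  rw [intersectionMultiplicity_eq_one] at h1
  · simp at h1
  · rw [← Localization.AtPrime.maximalIdeal_eq_span_pair hm]
    exact IsLocalRing.maximalIdeal.isMaximal _

/-- The norm equation over a two-dimensional Noetherian domain, with denominators cleared, has no
nontrivial solution. -/
theorem norm_equation_ne (hdim : ringKrullDim R ≤ 2) {π₁ π₂ π₃ : R}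
    (hm₁ : (Ideal.span {π₂, π₃}).IsMaximal) (hm₂ : (Ideal.span {π₁, π₃}).IsMaximal)
    (hm₃ : (Ideal.span {π₁, π₂}).IsMaximal)
    (h₁ : π₁ ∉ Ideal.span {π₂, π₃}) (h₂ : π₂ ∉ Ideal.span {π₁, π₃})
    (h₃ : π₃ ∉ Ideal.span {π₁, π₂})
    (hπ₁ : Prime π₁) (hπ₂ : Prime π₂) (hπ₃ : Prime π₃) {x₁ y₁ x₂ y₂ x₃ y₃ w : R} (hw : w ≠ 0) :
    (x₁ ^ 2 - π₂ * π₃ * y₁ ^ 2) * (x₂ ^ 2 - π₁ * π₃ * y₂ ^ 2) * (x₃ ^ 2 - π₁ * π₂ * y₃ ^ 2) ≠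
      π₁ * π₂ * π₃ * w ^ 2 := by
  intro h
  have h12 : ¬ π₁ ∣ π₂ := fun h ↦ h₂ (Ideal.mem_of_dvd _ h (Ideal.subset_span (by simp)))
  have h13 : ¬ π₁ ∣ π₃ := fun h ↦ h₃ (Ideal.mem_of_dvd _ h (Ideal.subset_span (by simp)))
  have h21 : ¬ π₂ ∣ π₁ := fun h ↦ h₁ (Ideal.mem_of_dvd _ h (Ideal.subset_span (by simp)))
  have h23 : ¬ π₂ ∣ π₃ := fun h ↦ h₃ (Ideal.mem_of_dvd _ h (Ideal.subset_span (by simp)))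
  have h31 : ¬ π₃ ∣ π₁ := fun h ↦ h₁ (Ideal.mem_of_dvd _ h (Ideal.subset_span (by simp)))
  have h32 : ¬ π₃ ∣ π₂ := fun h ↦ h₂ (Ideal.mem_of_dvd _ h (Ideal.subset_span (by simp)))
  have h0 : π₁ * π₂ * π₃ * w ^ 2 ≠ 0 := mul_ne_zero
    (mul_ne_zero (mul_ne_zero hπ₁.ne_zero hπ₂.ne_zero) hπ₃.ne_zero) (pow_ne_zero 2 hw)
  have h00 := h0
  rw [← h] at h00
  have hF₁ := left_ne_zero_of_mul (left_ne_zero_of_mul h00)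
  have hF₂ := right_ne_zero_of_mul (left_ne_zero_of_mul h00)
  have hF₃ := right_ne_zero_of_mul h00
  have s₁ := even_multiplicity_add_of_norm_equation hdim hm₁ rfl hπ₂ hπ₃ h32 h₁ hw h
  have s₂ := even_multiplicity_add_of_norm_equation (e := π₂) (x₁ := x₂) (y₁ := y₂) (x₂ := x₁)
    (y₂ := y₁) (x₃ := x₃) (y₃ := y₃) hdim hm₂ rfl hπ₁ hπ₃ h31 h₂ hw (by linear_combination h)
  have s₃ := even_multiplicity_add_of_norm_equation (e := π₃) (x₁ := x₃) (y₁ := y₃) (x₂ := x₁)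
    (y₂ := y₁) (x₃ := x₂) (y₃ := y₂) hdim hm₃ rfl hπ₁ hπ₂ h21 h₃ hw (by linear_combination h)
  have t₁ := even_multiplicity_of_norm (r := π₂) (x := x₁) (y := y₁) hdim hm₂ rfl hπ₁ h13 h₂
    (by rwa [mul_comm π₃])
  have t₂ := even_multiplicity_of_norm (r := π₁) (x := x₂) (y := y₂) hdim hm₁ rfl hπ₂ h23 h₁
    (by rwa [mul_comm π₃])
  have t₃ := even_multiplicity_of_norm (r := π₁) (x := x₃) (y := y₃) hdim hm₁ (Set.pair_comm _ _ ▸ rfl)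
    hπ₃ h32 h₁ (by rwa [mul_comm π₂])
  rw [mul_comm π₃] at t₁ t₂
  rw [mul_comm π₂] at t₃
  have expand {p : R} (hp : Prime p) :
      multiplicity p (x₁ ^ 2 - π₂ * π₃ * y₁ ^ 2) + multiplicity p (x₂ ^ 2 - π₁ * π₃ * y₂ ^ 2) +
        multiplicity p (x₃ ^ 2 - π₁ * π₂ * y₃ ^ 2) =
      multiplicity p π₁ + multiplicity p π₂ + multiplicity p π₃ + 2 * multiplicity p w := by
    have h4 := congrArg (multiplicity p) h
    rwa [multiplicity_mul hp (.of_prime_left hp h00),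
      multiplicity_mul hp (.of_prime_left hp (left_ne_zero_of_mul h00)),
      multiplicity_mul hp (.of_prime_left hp h0),
      multiplicity_mul hp (.of_prime_left hp (left_ne_zero_of_mul h0)),
      multiplicity_mul hp (.of_prime_left hp (left_ne_zero_of_mul (left_ne_zero_of_mul h0))),
      FiniteMultiplicity.multiplicity_pow hp (.of_prime_left hp hw)] at h4
  have e₁ := expand hπ₁
  have e₂ := expand hπ₂
  have e₃ := expand hπ₃
  rw [multiplicity_self, multiplicity_eq_zero.2 h12, multiplicity_eq_zero.2 h13] at e₁
  rw [multiplicity_self, multiplicity_eq_zero.2 h21, multiplicity_eq_zero.2 h23] at e₂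
  rw [multiplicity_self, multiplicity_eq_zero.2 h31, multiplicity_eq_zero.2 h32] at e₃
  -- The sum of `e₁`, `e₂`, `e₃` is odd on the right, while `s₁`, `s₂`, `s₃`, `t₁`, `t₂`, `t₃` make
  -- it even on the left.
  rw [Nat.even_iff] at s₁ s₂ s₃ t₁ t₂ t₃
  omega

end Semilocal

/-- Here `R` is a regular semi-local domain of dimension 2 with fraction field `K`. -/
theorem proposition4p1 {R : Type*} [CommRing R] [IsDomain R] [IsRegularRing R]
    {K : Type*} [Field K] [Algebra R K] [IsFractionRing R K]
    (hdim : ringKrullDim R = 2) (h2 : IsUnit (2 : R))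
    (m₁ m₂ m₃ : Ideal R) (π₁ π₂ π₃ : R)
    (hmax : ∀ I : Ideal R, I.IsMaximal ↔ I = m₁ ∨ I = m₂ ∨ I = m₃)
    (h₁₂ : m₁ ≠ m₂) (h₁₃ : m₁ ≠ m₃) (h₂₃ : m₂ ≠ m₃)
    (hm₁ : m₁ = Ideal.span {π₂, π₃})
    (hm₂ : m₂ = Ideal.span {π₁, π₃})
    (hm₃ : m₃ = Ideal.span {π₁, π₂})
    (hπ₁ : (Ideal.span {π₁}).IsPrime)
    (hπ₂ : (Ideal.span {π₂}).IsPrime)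
    (hπ₃ : (Ideal.span {π₃}).IsPrime)
    (a b c : K)
    (ha : a = algebraMap R K (π₂ * π₃))
    (hb : b = algebraMap R K (π₃ * π₁))
    (hc : c = algebraMap R K (π₁ * π₂ * π₃)) :
    IsEmpty (RationalPoints (threeNormVarietyStructure a b c)) := by
  rw [← not_nonempty_iff, nonempty_rationalPoints_threeNormVariety]
  rintro ⟨x₁, y₁, x₂, y₂, x₃, y₃, h⟩
  have notMem {I J : Ideal R} (hI : I = m₁ ∨ I = m₂ ∨ I = m₃) (hJ : J = m₁ ∨ J = m₂ ∨ J = m₃)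
      (hIJ : I ≠ J) : ¬ I ≤ J := fun hle ↦
    hIJ (((hmax I).2 hI).eq_of_le ((hmax J).2 hJ).ne_top hle)
  have h₁ : π₁ ∉ m₁ := fun hmem ↦ notMem (.inr (.inr rfl)) (.inl rfl) h₁₃.symm (by
    rw [hm₃, Ideal.span_le, Set.pair_subset_iff]
    exact ⟨hmem, hm₁ ▸ Ideal.subset_span (by simp)⟩)
  have h₂ : π₂ ∉ m₂ := fun hmem ↦ notMem (.inr (.inr rfl)) (.inr (.inl rfl)) h₂₃.symm (by
    rw [hm₃, Ideal.span_le, Set.pair_subset_iff]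
    exact ⟨hm₂ ▸ Ideal.subset_span (by simp), hmem⟩)
  have h₃ : π₃ ∉ m₃ := fun hmem ↦ notMem (.inr (.inl rfl)) (.inr (.inr rfl)) h₂₃ (by
    rw [hm₂, Ideal.span_le, Set.pair_subset_iff]
    exact ⟨hm₃ ▸ Ideal.subset_span (by simp), hmem⟩)
  have prime {π : R} {m : Ideal R} (hπm : π ∉ m) (hπ : (Ideal.span {π}).IsPrime) : Prime π :=
    (Ideal.span_singleton_prime (by rintro rfl; exact hπm m.zero_mem)).1 hπ
  obtain ⟨d, hd⟩ := IsLocalization.exist_integer_multiples_of_finite (nonZeroDivisors R)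
    ![x₁, y₁, x₂, y₂, x₃, y₃]
  obtain ⟨X₁, hX₁⟩ := hd 0
  obtain ⟨Y₁, hY₁⟩ := hd 1
  obtain ⟨X₂, hX₂⟩ := hd 2
  obtain ⟨Y₂, hY₂⟩ := hd 3
  obtain ⟨X₃, hX₃⟩ := hd 4
  obtain ⟨Y₃, hY₃⟩ := hd 5
  simp only [Algebra.smul_def, Matrix.cons_val] at hX₁ hY₁ hX₂ hY₂ hX₃ hY₃
  -- As ab = π₁π₂π₃², one π₃ is absorbed into Y₃. Six coordinates scaled by d multiply the equation
  -- by d⁶, so w = d³.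
  refine norm_equation_ne hdim.le (hm₁ ▸ (hmax _).2 (.inl rfl)) (hm₂ ▸ (hmax _).2 (.inr (.inl rfl)))
    (hm₃ ▸ (hmax _).2 (.inr (.inr rfl))) (hm₁ ▸ h₁) (hm₂ ▸ h₂) (hm₃ ▸ h₃) (prime h₁ hπ₁)
    (prime h₂ hπ₂) (prime h₃ hπ₃) (x₁ := X₁) (y₁ := Y₁) (x₂ := X₂) (y₂ := Y₂) (x₃ := X₃)
    (y₃ := π₃ * Y₃) (pow_ne_zero 3 (nonZeroDivisors.coe_ne_zero d)) (IsFractionRing.injective R K ?_)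
  simp only [map_mul, map_sub, map_pow, hX₁, hY₁, hX₂, hY₂, hX₃, hY₃]
  simp only [ha, hb, hc, map_mul] at h
  linear_combination algebraMap R K d ^ 6 * h
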